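/- Let $k\ge 1$ and $1\le i\le k$ be integers, and let $n,m\ge 0$ be integers. Let $F_{k,i}(n,m)$ be the number of partitions $p=(p_1\ge p_2\ge\dots\ge p_m\ge 1)$ of $n$ into exactly $m$ parts such that $p_l\ge p_{l+k-1}+2$ for all $l$ with $1\le l\le m-k+1$, and $p_{m-i+1}\ge 2$ if $m\ge i$ (that is, at most $i-1$ parts are equal to $1$). Let $G_{k,i}(n,m)$ be the number of $(k-1)$-tuples $(n^{(1)},\dots,n^{(k-1)})$ of (possibly empty) partitions $n^{(j)}=(n^{(j)}_1,\dots,n^{(j)}_{m_j})$, with $m_j\ge 0$ parts, such that for every $1\le j\le k-1$ $$n^{(j)}_\ell\ \ge\ n^{(j)}_{\ell+1}+2j\qquad(1\le \ell<m_j),$$ $$n^{(j)}_{m_j}\ \ge\ j+\max(j-i+1,0)+2j\,(m_{j+1}+\dots+m_{k-1})\qquad\text{if } m_j\ge 1,$$ and such that $$\sum_{j=1}^{k-1}\sum_{\ell=1}^{m_j}n^{(j)}_\ell=n,\qquad \sum_{j=1}^{k-1}j\,m_j=m.$$ Then $F_{k,i}(n,m)=G_{k,i}(n,m)$. Moreover,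 a partition satisfies the conditions defining $F_{k,i}$ if and only if $f_j+f_{j+1}\le k-1$ for all $j\ge 1$ and $f_1\le i-1$, where $f_j$ denotes the number of its parts equal to $j$. -/

import Mathlib

namespace BurgeBressoud

/-- The parts `(p₁, …, pₘ)` of a partition, listed in non-increasing order. The part `p_l` of the
usual one-based numbering is the entry `(seq p)[l - 1]`. -/
def seq {n : ℕ} (p : n.Partition) : List ℕ :=
  p.parts.sort (· ≥ ·)

/-- "Difference `2` at distance `k - 1`", `p_l ≥ p_{l+k-1} + 2` whenever both parts exist, and
`p_{m-i+1} ≥ 2` whenever this part exists. (The requirement `p_m ≥ 1` is part of `Nat.Partition`.)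
In zero-based numbering `p_{m-i+1}` is the entry with index `m - i`, and it exists iff `i ≤ m`
(for `i ≥ 1`). -/
def DiffCond (k i : ℕ) {n : ℕ} (p : n.Partition) : Prop :=
  (∀ l, ∀ _ : l + (k - 1) < (seq p).length, (seq p)[l + (k - 1)] + 2 ≤ (seq p)[l]) ∧
  (∀ _ : i ≤ (seq p).length, ∀ _ : (seq p).length - i < (seq p).length,
    2 ≤ (seq p)[(seq p).length - i])

/-- The frequency condition: `f_j + f_{j+1} ≤ k - 1` for all `j ≥ 1`, and `f_1 ≤ i - 1`, where
`f_j` is the number of parts equal to `j`. -/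
def FreqCond (k i : ℕ) {n : ℕ} (p : n.Partition) : Prop :=
  (∀ j, 1 ≤ j → p.parts.count j + p.parts.count (j + 1) ≤ k - 1) ∧ p.parts.count 1 ≤ i - 1

/-- `F_{k,i}(n,m)`: the number of partitions of `n` into `m` parts satisfying `DiffCond k i`. -/
noncomputable def F (k i n m : ℕ) : ℕ :=
  {p : n.Partition | p.parts.card = m ∧ DiffCond k i p}.ncard

/-- A multiple partition `(n^{(1)}, …, n^{(k-1)})`: a `(k-1)`-tuple of partitions of arbitrary
weights. The index `a : Fin (k - 1)` stands for the charge `j = a + 1`. -/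
abbrev MultiPartition (k : ℕ) : Type :=
  Fin (k - 1) → (w : ℕ) × w.Partition

namespace MultiPartition

variable {k : ℕ}

/-- The parts of `n^{(j)}`, `j = a + 1`, in non-increasing order. -/
def partsAt (P : MultiPartition k) (a : Fin (k - 1)) : List ℕ :=
  seq (P a).2

/-- The number of parts `m_j` of `n^{(j)}`, `j = a + 1`. -/
def len (P : MultiPartition k) (a : Fin (k - 1)) : ℕ :=
  (P.partsAt a).length

/-- The total weight: the sum of all parts of all the `n^{(j)}`. -/
def weight (P : MultiPartition k) : ℕ :=
  ∑ a, (P.partsAt a).sum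

/-- The total charge `∑_j j m_j`. -/
def charge (P : MultiPartition k) : ℕ :=
  ∑ a : Fin (k - 1), (a.val + 1) * P.len a

/-- The bound `Δ_{(i;j)} = j + max (j - i + 1, 0) + 2 j (m_{j+1} + ⋯ + m_{k-1})` with `j = a + 1`.
The truncated subtraction `j + 1 - i` of natural numbers is `max (j - i + 1, 0)`. -/
def bound (i : ℕ) (P : MultiPartition k) (a : Fin (k - 1)) : ℕ :=
  (a.val + 1) + ((a.val + 1) + 1 - i) + 2 * (a.val + 1) * ∑ b ∈ Finset.Ioi a, P.len b

/-- For every `j = a + 1`: `n^{(j)}_ℓ ≥ n^{(j)}_{ℓ+1} + 2j` for consecutive parts of `n^{(j)}`, and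
the smallest part of `n^{(j)}` (if there is one) is at least `Δ_{(i;j)}`. -/
def Admissible (i : ℕ) (P : MultiPartition k) : Prop :=
  ∀ a : Fin (k - 1),
    (∀ l, ∀ _ : l + 1 < (P.partsAt a).length,
      (P.partsAt a)[l + 1] + 2 * (a.val + 1) ≤ (P.partsAt a)[l]) ∧
    (∀ h : P.partsAt a ≠ [], P.bound i a ≤ (P.partsAt a).getLast h)

end MultiPartition

/-- The multiple partitions of weight `n` and charge `m` counted by `G_{k,i}(n,m)`. -/
def GSet (k i n m : ℕ) : Set (MultiPartition k) :=
  {P | P.weight = n ∧ P.charge = m ∧ P.Admissible i}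

/-- `G_{k,i}(n,m)`: the number of multiple partitions `(n^{(1)}, …, n^{(k-1)})` of total weight `n`
and total charge `m` satisfying the difference conditions and the lower bounds. -/
noncomputable def G (k i n m : ℕ) : ℕ :=
  (GSet k i n m).ncard

/-- The set counted by `G` is finite, so that `Set.ncard` is its honest number of elements. -/
theorem GSet_finite (k i n m : ℕ) : (GSet k i n m).Finite := by
  have hfin : Finite {x : (w : ℕ) × w.Partition | x.1 ≤ n} := by
    refine Finite.of_injective
      (β := (w : Fin (n + 1)) × (w.val).Partition)
      (fun x => ⟨⟨x.1.1, Nat.lt_succ_of_le x.2⟩, x.1.2⟩) ?_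
    rintro ⟨⟨w, p⟩, hw⟩ ⟨⟨w', p'⟩, hw'⟩ h
    simp only [Sigma.mk.injEq, Fin.mk.injEq] at h
    obtain ⟨rfl, h⟩ := h
    simpa using h
  refine (Set.Finite.pi' (fun _ : Fin (k - 1) => Set.toFinite
    {x : (w : ℕ) × w.Partition | x.1 ≤ n})).subset ?_
  rintro (P : MultiPartition k) ⟨hP, -, -⟩ a
  have h1 : (P.partsAt a).sum = (P a).1 := by
    have h2 : ((P.partsAt a : List ℕ) : Multiset ℕ).sum = (P a).2.parts.sum := by
      simp [MultiPartition.partsAt, seq]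
    rw [Multiset.sum_coe, (P a).2.parts_sum] at h2
    exact h2
  have h3 : (P.partsAt a).sum ≤ P.weight :=
    Finset.single_le_sum (f := fun b => (P.partsAt b).sum) (fun _ _ => Nat.zero_le _)
      (Finset.mem_univ a)
  change (P a).1 ≤ n
  omega

end BurgeBressoud

/-!
The generating functions `J_i(x) = ∑ F_{k,i}(n,m) q ^ n x ^ m` satisfy Andrews' equations
`J_{a+1}(x) = J_a(x) + (x q) ^ a J_{k-a}(x q)` for `a < k`: a partition with exactly `a` ones is
obtained from one with at most `k - 1 - a` ones by raising every part by `1` and adding `a` ones.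
Together with `J_0 = 0` and `J_i(0) = 1`, these equations determine all coefficients by induction on
`n` and `i`. On the other side, splitting off the partition of largest charge from a multiple
partition leaves a multiple partition whose lower bounds are shifted, so the generating function of
`G_{k,i}` is an iterated series. That this series solves the same equations follows by induction on
`k` from one identity for a single summation, in which the difference of two consecutive series
telescopes by means of `(1 - q ^ r) / (q)_r = 1 / (q)_{r-1}`.
-/

namespace BurgeBressoud

open PowerSeries Finset

/-! ### Andrews' functional equations -/

/-- The Euler product `1 / ((1 - q) (1 - q²) ⋯ (1 - q ^ r))`. -/
noncomputable def qInv (r : ℕ) : ℚ⟦X⟧ :=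
  (∏ j ∈ range r, (1 - X ^ (j + 1) : ℚ⟦X⟧))⁻¹

theorem one_sub_X_pow_mul_qInv_succ (r : ℕ) : (1 - X ^ (r + 1)) * qInv (r + 1) = qInv r := by
  have h : constantCoeff (1 - X ^ (r + 1) : ℚ⟦X⟧) ≠ 0 := by simp
  rw [qInv, prod_range_succ, PowerSeries.mul_inv_rev, ← mul_assoc,
    PowerSeries.mul_inv_cancel _ h, one_mul, qInv]

/-- With `q` the variable of the coefficients, the operator
`f(x) ↦ q ^ (j r² + c r) x ^ (j r) f(x q ^ (2 r)) / ((1 - q) ⋯ (1 - q ^ r))`. -/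
noncomputable def layer (j c r : ℕ) (f : ℚ⟦X⟧⟦X⟧) : ℚ⟦X⟧⟦X⟧ :=
  C (X ^ (j * r ^ 2 + c * r) * qInv r) * (X ^ (j * r) * rescale (X ^ (2 * r)) f)

theorem layer_add (j c r : ℕ) (f g : ℚ⟦X⟧⟦X⟧) :
    layer j c r (f + g) = layer j c r f + layer j c r g := by
  simp only [layer, map_add, mul_add]

theorem layer_zero_right (j c : ℕ) (f : ℚ⟦X⟧⟦X⟧) : layer j c 0 f = f := by
  simp [layer, qInv]

theorem coeff_layer_of_lt {j m r : ℕ} (h : m < j * r) (c : ℕ) (f : ℚ⟦X⟧⟦X⟧) :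
    coeff m (layer j c r f) = 0 := by
  rw [layer, coeff_C_mul, coeff_X_pow_mul', if_neg h.not_ge, mul_zero]

theorem layer_succ_sub_layer_succ (j c r : ℕ) (f : ℚ⟦X⟧⟦X⟧) :
    layer j c (r + 1) f - layer j (c + 1) (r + 1) f =
      C (X ^ (j * (r + 1) ^ 2 + c * (r + 1)) * qInv r) *
        (X ^ (j * (r + 1)) * rescale (X ^ (2 * (r + 1))) f) := by
  rw [layer, layer, ← sub_mul, ← map_sub, ← one_sub_X_pow_mul_qInv_succ r]
  ring_nf

theorem rescale_C {R : Type*} [CommSemiring R] (a b : R) : rescale a (C b) = C b := by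
  ext n
  cases n <;> simp [coeff_C]

theorem rescale_layer (t j c r : ℕ) (f : ℚ⟦X⟧⟦X⟧) :
    rescale (X ^ t) (layer j c r f) = C (X ^ (j * r ^ 2 + c * r + t * (j * r)) * qInv r) *
      (X ^ (j * r) * rescale (X ^ (t + 2 * r)) f) := by
  simp only [layer, map_mul, map_pow, rescale_X, rescale_C, rescale_rescale]
  ring_nf

theorem rescale_X_pow_mul_layer (a c r : ℕ) (f g : ℚ⟦X⟧⟦X⟧) :
    rescale X (X ^ a * layer (a + c) a r (g + rescale X (X ^ c * f))) =
      layer (a + c) c r (rescale X (X ^ a * g)) +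
        (layer (a + c) c (r + 1) f - layer (a + c) (c + 1) (r + 1) f) := by
  rw [layer_succ_sub_layer_succ]
  simp only [layer, map_mul, map_add, map_pow, rescale_X, rescale_C, rescale_rescale]
  ring_nf

/-- The operator `f(x) ↦ ∑ r, q ^ (j r² + c r) x ^ (j r) f(x q ^ (2 r)) / ((1 - q) ⋯ (1 - q ^ r))`,
for `j ≥ 1`. Only the summands with `j r ≤ m`, hence `r ≤ m`, contribute to the coefficient of
`x ^ m`. -/
noncomputable def layerSum (j c : ℕ) (f : ℚ⟦X⟧⟦X⟧) : ℚ⟦X⟧⟦X⟧ :=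
  mk fun m => ∑ r ∈ range (m + 1), coeff m (layer j c r f)

theorem coeff_layerSum {j m N : ℕ} (hj : 0 < j) (hN : m < N) (c : ℕ) (f : ℚ⟦X⟧⟦X⟧) :
    coeff m (layerSum j c f) = ∑ r ∈ range N, coeff m (layer j c r f) := by
  rw [layerSum, coeff_mk]
  refine sum_subset (range_subset_range.2 hN) fun r _ hr => coeff_layer_of_lt ?_ c f
  rw [mem_range, not_lt] at hr
  nlinarith

theorem coeff_rescale_X_pow_mul_layerSum {j m N : ℕ} (hj : 0 < j) (hN : m < N) (t a c : ℕ)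
    (f : ℚ⟦X⟧⟦X⟧) :
    coeff m (rescale (X ^ t) (X ^ a * layerSum j c f)) =
      ∑ r ∈ range N, coeff m (rescale (X ^ t) (X ^ a * layer j c r f)) := by
  simp only [coeff_rescale, coeff_X_pow_mul', ← mul_sum]
  split_ifs with h
  · rw [coeff_layerSum hj (by omega : m - a < N)]
  · simp

theorem layerSum_add_rescale {a c : ℕ} (h : 0 < a + c) (f g : ℚ⟦X⟧⟦X⟧) :
    layerSum (a + c) c (f + rescale X (X ^ a * g)) = layerSum (a + c) (c + 1) f +
      rescale X (X ^ a * layerSum (a + c) a (g + rescale X (X ^ c * f))) := by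
  ext1 m
  set D : ℕ → ℚ⟦X⟧ := fun r =>
    coeff m (layer (a + c) c r f) - coeff m (layer (a + c) (c + 1) r f) with hD
  have telescope : ∑ r ∈ range (m + 1), D (r + 1) = ∑ r ∈ range (m + 1), D r := by
    have hm : m < (a + c) * (m + 1) := by nlinarith
    have h0 : D 0 = 0 := by simp only [hD, layer_zero_right, sub_self]
    have hlast : D (m + 1) = 0 := by simp only [hD, coeff_layer_of_lt hm, sub_self]
    rw [← add_zero (∑ r ∈ range (m + 1), D (r + 1)), ← h0, ← sum_range_succ', sum_range_succ,
      hlast, add_zero]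
  have hrescale := coeff_rescale_X_pow_mul_layerSum h m.lt_succ_self 1 a a
    (g + rescale X (X ^ c * f))
  simp only [pow_one, rescale_X_pow_mul_layer, map_add, map_sub, sum_add_distrib] at hrescale
  rw [map_add, hrescale, telescope]
  simp only [coeff_layerSum h m.lt_succ_self, layer_add, map_add, sum_add_distrib, hD,
    sum_sub_distrib]
  ring

/-- Andrews' multiple series `∑ x ^ (N₁ + ⋯ + N_K) q ^ (N₁² + ⋯ + N_K² + N_i + ⋯ + N_K) /
((q)_{N₁ - N₂} ⋯ (q)_{N_{K-1} - N_K} (q)_{N_K})` in `x`, with coefficients in `ℚ⟦q⟧`, as an iterated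
sum whose outermost index is `r = N_K`; by convention it vanishes for `i = 0`. -/
noncomputable def multiSum (i : ℕ) : ℕ → ℚ⟦X⟧⟦X⟧
  | 0 => if i = 0 then 0 else 1
  | K + 1 => layerSum (K + 1) (K + 2 - i) (multiSum i K)

theorem layerSum_zero (j c : ℕ) : layerSum j c 0 = 0 := by
  ext1 m
  simp [layerSum, layer]

theorem multiSum_index_zero (K : ℕ) : multiSum 0 K = 0 := by
  induction K with
  | zero => rfl
  | succ K ih => rw [multiSum, ih, layerSum_zero]

theorem multiSum_succ_of_lt {i K : ℕ} (h : K < i) : multiSum (i + 1) K = multiSum i K := by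
  induction K with
  | zero => simp [multiSum, h.ne']
  | succ K ih =>
    rw [multiSum, multiSum, ih (by omega), Nat.sub_eq_zero_of_le (by omega : K + 2 ≤ i),
      Nat.sub_eq_zero_of_le (by omega : K + 2 ≤ i + 1)]

theorem multiSum_succ_index (K : ℕ) : ∀ a b, a + b = K + 1 →
    multiSum (a + 1) K = multiSum a K + rescale X (X ^ a * multiSum b K) := by
  induction K with
  | zero =>
    intro a b h
    obtain ⟨rfl, rfl⟩ | ⟨rfl, rfl⟩ : a = 0 ∧ b = 1 ∨ a = 1 ∧ b = 0 := by omega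
    all_goals simp [multiSum]
  | succ K ih =>
    rintro a (_ | c) h
    · rw [multiSum_succ_of_lt (by omega), multiSum_index_zero, mul_zero, map_zero, add_zero]
    · have hac : a + c = K + 1 := by omega
      simp only [multiSum]
      rw [ih a c hac, ih c a (by omega), ← hac, show K + 2 - (a + 1) = c by omega,
        show K + 2 - a = c + 1 by omega, show K + 2 - (c + 1) = a by omega,
        layerSum_add_rescale (by omega)]

theorem constantCoeff_layerSum {j : ℕ} (c : ℕ) (f : ℚ⟦X⟧⟦X⟧) :
    constantCoeff (layerSum j c f) = constantCoeff f := by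
  rw [← coeff_zero_eq_constantCoeff_apply, layerSum, coeff_mk, zero_add, sum_range_one,
    layer_zero_right, coeff_zero_eq_constantCoeff_apply]

theorem constantCoeff_multiSum {i : ℕ} (hi : 0 < i) (K : ℕ) : constantCoeff (multiSum i K) = 1 := by
  induction K with
  | zero => simp [multiSum, hi.ne']
  | succ K ih => rw [multiSum, constantCoeff_layerSum, ih]

/-- Andrews' functional equations for a family of power series `f i` in `x` with coefficients in
`ℚ⟦q⟧`, namely `f (a + 1)(x) = f a (x) + (x q) ^ a f (K + 1 - a)(x q)` for `a ≤ K`, together with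
the normalization `f 0 = 0` and `f i (0) = 1` for `i > 0`. -/
structure AndrewsSystem (K : ℕ) (f : ℕ → ℚ⟦X⟧⟦X⟧) : Prop where
  index_zero : f 0 = 0
  constantCoeff_succ : ∀ a, constantCoeff (f (a + 1)) = 1
  index_succ : ∀ a c, a + c = K → f (a + 1) = f a + rescale X (X ^ a * f (c + 1))

theorem andrewsSystem_multiSum (K : ℕ) : AndrewsSystem K fun i => multiSum i K where
  index_zero := multiSum_index_zero K
  constantCoeff_succ a := constantCoeff_multiSum a.succ_pos K
  index_succ a c h := multiSum_succ_index K a (c + 1) (by omega)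

theorem AndrewsSystem.coeff_coeff_succ {K : ℕ} {f : ℕ → ℚ⟦X⟧⟦X⟧} (hf : AndrewsSystem K f)
    {a c : ℕ} (h : a + c = K) (m n : ℕ) :
    coeff n (coeff m (f (a + 1))) = coeff n (coeff m (f a)) +
      if m ≤ n ∧ a ≤ m then coeff (n - m) (coeff (m - a) (f (c + 1))) else 0 := by
  rw [hf.index_succ a c h, map_add, map_add, coeff_rescale, coeff_X_pow_mul', coeff_X_pow_mul',
    ite_and, apply_ite (coeff (n - m)), map_zero]

theorem AndrewsSystem.eq {K : ℕ} {f g : ℕ → ℚ⟦X⟧⟦X⟧} (hf : AndrewsSystem K f)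
    (hg : AndrewsSystem K g) {i : ℕ} (hi : i ≤ K + 1) : f i = g i := by
  suffices h : ∀ n m i, i ≤ K + 1 → coeff n (coeff m (f i)) = coeff n (coeff m (g i)) by
    ext m n
    exact h n m i hi
  intro n
  induction n using Nat.strong_induction_on with
  | _ n ihn =>
    intro m i hi
    induction i with
    | zero => rw [hf.index_zero, hg.index_zero]
    | succ a iha =>
      rcases Nat.eq_zero_or_pos m with rfl | hm
      · simp only [coeff_zero_eq_constantCoeff_apply, hf.constantCoeff_succ, hg.constantCoeff_succ]
      · have hac : a + (K - a) = K := by omega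
        rw [hf.coeff_coeff_succ hac, hg.coeff_coeff_succ hac, iha (by omega)]
        congr 1
        split_ifs
        · exact ihn (n - m) (by omega) _ _ (by omega)
        · rfl

/-! ### Counting by weight and charge -/

section Counting

variable {α β γ : Type*}

theorem ncard_eq_sum_ncard_fiber {U : Set α} (hU : U.Finite) (f : α → β) (t : Finset β)
    (hf : ∀ x ∈ U, f x ∈ t) : U.ncard = ∑ b ∈ t, {x ∈ U | f x = b}.ncard := by
  classical
  lift U to Finset α using hU
  rw [Set.ncard_coe_finset, card_eq_sum_card_fiberwise (t := t) hf]
  refine sum_congr rfl fun b _ => ?_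
  rw [← Set.ncard_coe_finset, coe_filter]
  rfl

/-- Finiteness of the sets counted by the coefficients of `weightSeries S w`; without it `Set.ncard`
returns the junk value `0`. -/
def FiniteFibers (S : Set α) (w : α → ℕ) : Prop :=
  ∀ n, {x ∈ S | w x = n}.Finite

theorem FiniteFibers.empty (w : α → ℕ) : FiniteFibers ∅ w := fun n => by
  rw [Set.sep_empty]
  exact Set.finite_empty

theorem FiniteFibers.of_fibers {S : Set α} {w : α → ℕ} {f : α → β} {t : Finset β}
    (hf : ∀ x ∈ S, f x ∈ t) (h : ∀ b ∈ t, FiniteFibers {x ∈ S | f x = b} w) :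
    FiniteFibers S w := fun n =>
  (t.finite_toSet.biUnion fun b hb => h b hb n).subset fun x hx =>
    Set.mem_biUnion (hf x hx.1) ⟨⟨hx.1, rfl⟩, hx.2⟩

theorem FiniteFibers.prod {S : Set α} {T : Set β} {w : α → ℕ} {v : β → ℕ}
    (hS : FiniteFibers S w) (hT : FiniteFibers T v) :
    FiniteFibers (S ×ˢ T) fun x => w x.1 + v x.2 := fun n =>
  ((antidiagonal n).finite_toSet.biUnion fun b _ => (hS b.1).prod (hT b.2)).subset fun x hx =>
    Set.mem_biUnion (x := (w x.1, v x.2)) (HasAntidiagonal.mem_antidiagonal.2 hx.2)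
      ⟨⟨hx.1.1, rfl⟩, hx.1.2, rfl⟩

/-- The generating function `∑ x ∈ S, q ^ (w x)`, in the variable `q`, of a set with finite fibers.
The coefficients are taken in `ℚ` so that series with constant coefficient `1` can be inverted. -/
noncomputable def weightSeries (S : Set α) (w : α → ℕ) : ℚ⟦X⟧ :=
  mk fun n => ({x ∈ S | w x = n}.ncard : ℚ)

theorem weightSeries_empty (w : α → ℕ) : weightSeries ∅ w = 0 := by
  ext n
  simp [weightSeries]

theorem weightSeries_singleton (x : α) (w : α → ℕ) : weightSeries {x} w = X ^ w x := by
  ext n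
  rw [weightSeries, coeff_mk, coeff_X_pow]
  split_ifs with h
  · rw [Set.sep_eq_self_iff_mem_true.2 (by simpa using h.symm), Set.ncard_singleton, Nat.cast_one]
  · rw [Set.sep_eq_empty_iff_mem_false.2 (by simpa using Ne.symm h), Set.ncard_empty, Nat.cast_zero]

theorem weightSeries_eq_sum {S : Set α} {w : α → ℕ} (hS : FiniteFibers S w) (f : α → β)
    (t : Finset β) (hf : ∀ x ∈ S, f x ∈ t) :
    weightSeries S w = ∑ b ∈ t, weightSeries {x ∈ S | f x = b} w := by
  ext n
  simp only [map_sum, weightSeries, coeff_mk]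
  rw [ncard_eq_sum_ncard_fiber (hS n) f t fun x hx => hf x hx.1, Nat.cast_sum]
  simp only [Set.mem_ofPred_eq, and_right_comm]

theorem weightSeries_prod {S : Set α} {T : Set β} {w : α → ℕ} {v : β → ℕ}
    (hS : FiniteFibers S w) (hT : FiniteFibers T v) :
    weightSeries (S ×ˢ T) (fun x => w x.1 + v x.2) = weightSeries S w * weightSeries T v := by
  ext n
  have hfiber : ∀ b ∈ antidiagonal n,
      {x ∈ {x ∈ S ×ˢ T | w x.1 + v x.2 = n} | (w x.1, v x.2) = b} =
        {x ∈ S | w x = b.1} ×ˢ {x ∈ T | v x = b.2} := by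
    rintro ⟨b, c⟩ hb
    rw [HasAntidiagonal.mem_antidiagonal] at hb
    ext x
    simp only [Set.mem_ofPred_eq, Set.mem_prod, Prod.mk.injEq]
    grind
  simp only [coeff_mul, weightSeries, coeff_mk]
  rw [ncard_eq_sum_ncard_fiber (hS.prod hT n) (fun x => (w x.1, v x.2)) (antidiagonal n)
    fun x hx => by simpa using hx.2, Nat.cast_sum]
  refine sum_congr rfl fun b hb => ?_
  rw [hfiber b hb, Set.ncard_prod, Nat.cast_mul]

theorem bijOn_fiber {S : Set α} {T : Set β} {f : α → β} (hf : Set.BijOn f S T) {w : α → γ}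
    {v : β → γ} {g : γ → γ} (hg : g.Injective)
    (hw : ∀ x ∈ S, v (f x) = g (w x)) (n : γ) :
    Set.BijOn f {x ∈ S | w x = n} {y ∈ T | v y = g n} := by
  refine ⟨?_, hf.injOn.mono (Set.sep_subset _ _), ?_⟩
  · rintro x ⟨hx, rfl⟩
    exact ⟨hf.mapsTo hx, hw x hx⟩
  · rintro y ⟨hy, hn⟩
    obtain ⟨x, hx, rfl⟩ := hf.surjOn hy
    exact ⟨x, ⟨hx, hg ((hw x hx).symm.trans hn)⟩, rfl⟩

theorem sep_eq_empty_of_surjOn {S : Set α} {T : Set β} {f : α → β} (hf : Set.SurjOn f S T)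
    {v : β → ℕ} {b n : ℕ} (hv : ∀ x ∈ S, b ≤ v (f x)) (hn : n < b) : {y ∈ T | v y = n} = ∅ := by
  rw [Set.sep_eq_empty_iff_mem_false]
  intro y hy hvy
  obtain ⟨x, hx, rfl⟩ := hf hy
  exact (hn.trans_le (hv x hx)).ne' hvy

theorem weightSeries_bijOn {S : Set α} {T : Set β} {w : α → ℕ} {v : β → ℕ} {f : α → β} {b : ℕ}
    (hf : Set.BijOn f S T) (hw : ∀ x ∈ S, v (f x) = w x + b) :
    weightSeries T v = X ^ b * weightSeries S w := by
  ext n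
  simp only [coeff_X_pow_mul', weightSeries, coeff_mk]
  split_ifs with h
  · obtain ⟨n, rfl⟩ := Nat.exists_eq_add_of_le' h
    rw [Nat.add_sub_cancel, (bijOn_fiber hf (add_left_injective b) hw n).ncard_eq]
  · rw [sep_eq_empty_of_surjOn hf.surjOn (fun x hx => (hw x hx).symm ▸ Nat.le_add_left b _)
      (not_le.1 h), Set.ncard_empty, Nat.cast_zero]

/-- The generating function `∑ y ∈ S, q ^ (w y) x ^ (c y)`, as a power series in `x` whose
coefficients are power series in `q`; the exponent `c` is called the charge. -/
noncomputable def genSeries (S : Set α) (w c : α → ℕ) : ℚ⟦X⟧⟦X⟧ :=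
  mk fun m => weightSeries {x ∈ S | c x = m} w

theorem coeff_coeff_genSeries (S : Set α) (w c : α → ℕ) (m n : ℕ) :
    coeff n (coeff m (genSeries S w c)) = ({x ∈ S | c x = m ∧ w x = n}.ncard : ℚ) := by
  simp only [genSeries, weightSeries, coeff_mk, Set.mem_ofPred_eq, and_assoc]

theorem genSeries_empty (w c : α → ℕ) : genSeries ∅ w c = 0 := by
  ext1 m
  rw [genSeries, coeff_mk, Set.sep_empty, weightSeries_empty, map_zero]

theorem genSeries_singleton (x : α) (w c : α → ℕ) :
    genSeries {x} w c = C (X ^ w x) * X ^ c x := by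
  ext1 m
  rw [genSeries, coeff_mk, coeff_C_mul, coeff_X_pow]
  split_ifs with h
  · rw [Set.sep_eq_self_iff_mem_true.2 (by simpa using h.symm), weightSeries_singleton, mul_one]
  · rw [Set.sep_eq_empty_iff_mem_false.2 (by simpa using Ne.symm h), weightSeries_empty, mul_zero]

theorem constantCoeff_genSeries {S : Set α} {w c : α → ℕ} {x : α} (h : {y ∈ S | c y = 0} = {x}) :
    constantCoeff (genSeries S w c) = X ^ w x := by
  rw [← coeff_zero_eq_constantCoeff_apply, genSeries, coeff_mk, h, weightSeries_singleton]

theorem genSeries_eq_add {S : Set α} {w c : α → ℕ}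
    (hS : ∀ m, FiniteFibers {x ∈ S | c x = m} w) (p : α → Prop) :
    genSeries S w c = genSeries {x ∈ S | p x} w c + genSeries {x ∈ S | ¬ p x} w c := by
  classical
  ext1 m
  simp only [map_add, genSeries, coeff_mk]
  rw [weightSeries_eq_sum (hS m) (fun x => decide (p x)) univ fun _ _ => mem_univ _,
    Fintype.sum_bool]
  simp only [Set.mem_ofPred_eq, decide_eq_true_eq, decide_eq_false_iff_not, and_right_comm]

theorem genSeries_bijOn {S : Set α} {T : Set β} {w c : α → ℕ} {v d : β → ℕ} {f : α → β}
    {t a b : ℕ} (hf : Set.BijOn f S T) (hd : ∀ x ∈ S, d (f x) = c x + a)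
    (hv : ∀ x ∈ S, v (f x) = w x + (t * c x + b)) :
    genSeries T v d = C (X ^ b) * (X ^ a * rescale (X ^ t) (genSeries S w c)) := by
  ext1 m
  rw [coeff_C_mul, coeff_X_pow_mul', genSeries, coeff_mk]
  split_ifs with h
  · obtain ⟨m, rfl⟩ := Nat.exists_eq_add_of_le' h
    rw [Nat.add_sub_cancel, coeff_rescale, genSeries, coeff_mk, weightSeries_bijOn (b := t * m + b)
      (bijOn_fiber hf (add_left_injective a) hd m)]
    · ring
    · rintro x ⟨hx, rfl⟩
      exact hv x hx
  · rw [sep_eq_empty_of_surjOn hf.surjOn (fun x hx => (hd x hx).symm ▸ Nat.le_add_left a _)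
      (not_le.1 h), weightSeries_empty, mul_zero]

theorem genSeries_eq_of_bijOn {S : Set α} {T : Set β} {w c : α → ℕ} {v d : β → ℕ} {f : α → β}
    (hf : Set.BijOn f S T) (hd : ∀ x ∈ S, d (f x) = c x) (hv : ∀ x ∈ S, v (f x) = w x) :
    genSeries T v d = genSeries S w c := by
  simpa using genSeries_bijOn (t := 0) (a := 0) (b := 0) hf hd (by simpa using hv)

theorem coeff_genSeries_sigma {S : Set α} {T : ℕ → Set β} {w c : α → ℕ} {v d : β → ℕ} {j m N : ℕ}
    (hj : 0 < j) (hN : m < N) (hS : ∀ r, FiniteFibers {x ∈ S | c x = r} w)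
    (hT : ∀ r m, FiniteFibers {y ∈ T r | d y = m} v) :
    coeff m (genSeries {p : α × β | p.1 ∈ S ∧ p.2 ∈ T (c p.1)} (fun p => w p.1 + v p.2)
        fun p => j * c p.1 + d p.2) =
      ∑ r ∈ range N,
        coeff m (C (coeff r (genSeries S w c)) * (X ^ (j * r) * genSeries (T r) v d)) := by
  simp only [coeff_C_mul, coeff_X_pow_mul', genSeries, coeff_mk]
  set U := {p ∈ {p : α × β | p.1 ∈ S ∧ p.2 ∈ T (c p.1)} | j * c p.1 + d p.2 = m} with hU
  have hfiber : ∀ r, {p ∈ U | c p.1 = r} =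
      if j * r ≤ m then {x ∈ S | c x = r} ×ˢ {y ∈ T r | d y = m - j * r} else ∅ := by
    intro r
    ext p
    split_ifs <;>
    · simp only [hU, Set.mem_ofPred_eq, Set.mem_prod, Set.mem_empty_iff_false]
      grind
  have hlt : ∀ p ∈ U, c p.1 ∈ range N := by
    rintro p ⟨-, hp⟩
    rw [mem_range]
    nlinarith
  have hfin : FiniteFibers U fun p => w p.1 + v p.2 := by
    refine .of_fibers hlt fun r _ => ?_
    rw [hfiber]
    split_ifs
    · exact (hS r).prod (hT r _)
    · exact .empty _
  rw [weightSeries_eq_sum hfin (fun p => c p.1) (range N) hlt]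
  refine sum_congr rfl fun r _ => ?_
  rw [hfiber]
  split_ifs
  · exact weightSeries_prod (hS r) (hT r _)
  · rw [weightSeries_empty, mul_zero]

end Counting

/-! ### Multiple partitions -/

theorem finite_setOf_length_le_sum_le (m n : ℕ) :
    {l : List ℕ | l.length ≤ m ∧ l.sum ≤ n}.Finite := by
  refine ((List.finite_length_le (Fin (n + 1)) m).image (List.map Fin.val)).subset ?_
  rintro l ⟨hlength, hsum⟩
  refine ⟨l.pmap (fun x hx => ⟨x, hx⟩) fun x hx => ?_, ?_, ?_⟩
  · exact Nat.lt_succ_of_le ((List.le_sum_of_mem hx).trans hsum)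
  · simpa using hlength
  · simp [List.map_pmap]

theorem finiteFibers_list (S : Set (List ℕ)) (m : ℕ) :
    FiniteFibers {l ∈ S | l.length = m} List.sum := fun n =>
  (finite_setOf_length_le_sum_le m n).subset fun _ h => ⟨h.1.2.le, h.2.le⟩

/-- A list whose entries are at least `b` and increase by at least `d` at each step: a partition
with difference conditions, listed from its smallest part. The condition is imposed on all pairs of
entries rather than on neighbours. -/
def Spaced (d b : ℕ) (l : List ℕ) : Prop :=
  l.Pairwise (fun x y => x + d ≤ y) ∧ ∀ x ∈ l, b ≤ x

theorem spaced_cons {d b x : ℕ} {l : List ℕ} :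
    Spaced d b (x :: l) ↔ b ≤ x ∧ Spaced d (x + d) l := by
  simp only [Spaced, List.pairwise_cons, List.forall_mem_cons]
  grind

theorem spaced_map_add {d b : ℕ} (c : ℕ) {l : List ℕ} :
    Spaced d (b + c) (l.map (· + c)) ↔ Spaced d b l := by
  simp [Spaced, List.pairwise_map, add_right_comm]

theorem bijOn_map_add (d b c : ℕ) :
    Set.BijOn (List.map (· + c)) {l | Spaced d b l} {l | Spaced d (b + c) l} := by
  refine ⟨fun l => (spaced_map_add c).2,
    (List.map_injective_iff.2 (add_left_injective c)).injOn, fun l hl => ?_⟩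
  have hmap : (l.map (· - c)).map (· + c) = l := by
    rw [List.map_map]
    refine (List.map_congr_left fun x hx => ?_).trans (List.map_id l)
    exact Nat.sub_add_cancel (le_of_add_le_right (hl.2 x hx))
  exact ⟨l.map (· - c), (spaced_map_add c).1 (by rwa [hmap]), hmap⟩

theorem bijOn_cons (d b : ℕ) :
    Set.BijOn (List.cons b) {l | Spaced d (b + d) l}
      {l ∈ {l | Spaced d b l} | l.head? = some b} := by
  refine ⟨fun l hl => ⟨spaced_cons.2 ⟨le_rfl, hl⟩, rfl⟩, List.cons_injective.injOn, ?_⟩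
  rintro (_ | ⟨x, l⟩) ⟨hl, hx⟩
  · cases hx
  · obtain rfl : x = b := by simpa using hx
    exact ⟨l, (spaced_cons.1 hl).2, rfl⟩

theorem setOf_spaced_sep_head_ne (d b : ℕ) :
    {l ∈ {l | Spaced d b l} | ¬ l.head? = some b} = {l | Spaced d (b + 1) l} := by
  ext (_ | ⟨x, l⟩)
  · simp [Spaced]
  · simp only [Set.mem_ofPred_eq, spaced_cons, List.head?_cons, Option.some.injEq]
    grind

theorem genSeries_spaced (d b : ℕ) :
    genSeries {l | Spaced d b l} List.sum List.length =
      C (X ^ b) * (X * rescale (X ^ d) (genSeries {l | Spaced d b l} List.sum List.length)) +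
        rescale X (genSeries {l | Spaced d b l} List.sum List.length) := by
  refine (genSeries_eq_add (finiteFibers_list _) (fun l => l.head? = some b)).trans ?_
  congr 1
  · have h := genSeries_bijOn (w := List.sum) (c := List.length) (v := List.sum) (d := List.length)
      (t := d) (a := 1) (b := b) ((bijOn_cons d b).comp (bijOn_map_add d b d)) (by simp)
      fun l _ => by
        simp only [Function.comp_apply, List.sum_cons, List.sum_map_add, List.map_id',
          List.map_const', List.sum_replicate, smul_eq_mul]
        ring
    rwa [pow_one] at h
  · rw [setOf_spaced_sep_head_ne]
    simpa using genSeries_bijOn (w := List.sum) (c := List.length) (v := List.sum)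
      (d := List.length) (t := 1) (a := 0) (b := 0) (bijOn_map_add d b 1) (by simp)
      (by simp [List.sum_map_add])

theorem coeff_genSeries_spaced (d b r : ℕ) :
    coeff r (genSeries {l | Spaced d b l} List.sum List.length) =
      X ^ (b * r + d * r.choose 2) * qInv r := by
  induction r with
  | zero =>
    have hnil : {l ∈ {l | Spaced d b l} | l.length = 0} = {[]} := by
      ext l
      simp only [Set.mem_ofPred_eq, List.length_eq_zero_iff, Set.mem_singleton_iff,
        and_iff_right_iff_imp]
      rintro rfl
      simp [Spaced]
    rw [coeff_zero_eq_constantCoeff_apply, constantCoeff_genSeries hnil]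
    simp [qInv]
  | succ r ih =>
    have h := congrArg (coeff (r + 1)) (genSeries_spaced d b)
    rw [map_add, coeff_C_mul, coeff_succ_X_mul, coeff_rescale, coeff_rescale, ih] at h
    have hne : (1 - X ^ (r + 1) : ℚ⟦X⟧) ≠ 0 := fun h0 => by simpa using congrArg constantCoeff h0
    refine mul_left_cancel₀ hne ?_
    have hchoose : (r + 1).choose 2 = r + r.choose 2 := by
      rw [Nat.choose_succ_succ', Nat.choose_one_right]
    rw [mul_left_comm, one_sub_X_pow_mul_qInv_succ, hchoose]
    linear_combination h

theorem coeff_genSeries_spaced_two_mul (j c s r : ℕ) :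
    coeff r (genSeries {l | Spaced (2 * j) (j + c + 2 * j * s) l} List.sum List.length) =
      X ^ (j * r ^ 2 + c * r + 2 * s * (j * r)) * qInv r := by
  have hchoose : 2 * r.choose 2 + r = r ^ 2 := by
    induction r with
    | zero => rfl
    | succ r ih => rw [Nat.choose_succ_succ', Nat.choose_one_right]; linarith
  rw [coeff_genSeries_spaced, ← hchoose]
  ring_nf

/-- Tuples of partitions subject to the conditions of `MultiPartition.Admissible`, each listed from
its smallest part and with all the sums `m_{j+1} + ⋯ + m_{k-1}` increased by `s`. The parameter `s`
stands for the number of parts in the partitions split off at the end of the tuple. -/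
def spacedTuples (K i s : ℕ) : Set (Fin K → List ℕ) :=
  {P | ∀ a, Spaced (2 * (a.val + 1)) ((a.val + 1) + ((a.val + 1) + 1 - i) +
    2 * (a.val + 1) * (∑ b ∈ Ioi a, (P b).length + s)) (P a)}

/-- The total weight of a tuple of partitions. -/
def tupleWeight {K : ℕ} (P : Fin K → List ℕ) : ℕ :=
  ∑ a, (P a).sum

/-- The total charge of a tuple of partitions; the parts of `P a` have charge `a + 1`. -/
def tupleCharge {K : ℕ} (P : Fin K → List ℕ) : ℕ :=
  ∑ a : Fin K, (a.val + 1) * (P a).length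

theorem finiteFibers_tuple {K : ℕ} (S : Set (Fin K → List ℕ)) (m : ℕ) :
    FiniteFibers {P ∈ S | tupleCharge P = m} tupleWeight := fun n => by
  refine (Set.Finite.pi' fun _ : Fin K => finite_setOf_length_le_sum_le m n).subset ?_
  rintro P ⟨⟨-, rfl⟩, rfl⟩ a
  constructor
  · exact (Nat.le_mul_of_pos_left _ a.val.succ_pos).trans (single_le_sum
      (f := fun a : Fin K => (a.val + 1) * (P a).length) (fun _ _ => Nat.zero_le _) (mem_univ a))
  · exact single_le_sum (f := fun a : Fin K => (P a).sum) (fun _ _ => Nat.zero_le _) (mem_univ a)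

theorem sum_Ioi_castSucc {M : Type*} [AddCommMonoid M] {K : ℕ} (a : Fin K) (f : Fin (K + 1) → M) :
    ∑ b ∈ Ioi a.castSucc, f b = ∑ b ∈ Ioi a, f b.castSucc + f (Fin.last K) := by
  simp only [← filter_lt_eq_Ioi, sum_filter, Fin.sum_univ_castSucc, Fin.castSucc_lt_castSucc_iff,
    Fin.castSucc_lt_last, if_true]

theorem snoc_mem_spacedTuples {K i s : ℕ} (l : List ℕ) (P : Fin K → List ℕ) :
    (Fin.snoc P l : Fin (K + 1) → List ℕ) ∈ spacedTuples (K + 1) i s ↔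
      Spaced (2 * (K + 1)) (K + 1 + (K + 2 - i) + 2 * (K + 1) * s) l ∧
        P ∈ spacedTuples K i (s + l.length) := by
  have hlast : Ioi (Fin.last K) = ∅ := Ioi_top
  simp only [spacedTuples, Set.mem_ofPred_eq, Fin.forall_fin_succ', sum_Ioi_castSucc,
    Fin.snoc_castSucc, Fin.snoc_last, Fin.val_castSucc, Fin.val_last, hlast,
    sum_empty, zero_add, add_assoc, Nat.reduceAdd, add_comm s]
  exact and_comm

theorem bijOn_snoc (K i s : ℕ) :
    Set.BijOn (fun p : List ℕ × (Fin K → List ℕ) => (Fin.snoc p.2 p.1 : Fin (K + 1) → List ℕ))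
      {p | p.1 ∈ {l | Spaced (2 * (K + 1)) (K + 1 + (K + 2 - i) + 2 * (K + 1) * s) l} ∧
        p.2 ∈ spacedTuples K i (s + p.1.length)}
      (spacedTuples (K + 1) i s) := by
  refine ⟨fun p => (snoc_mem_spacedTuples p.1 p.2).2, ?_, fun P hP => ?_⟩
  · rintro ⟨l, P⟩ - ⟨l', P'⟩ - h
    obtain ⟨hP, hl⟩ := Fin.snoc_inj.1 h
    exact Prod.ext hl hP
  · rw [← Fin.snoc_init_self P] at hP
    exact ⟨(P (Fin.last K), Fin.init P), (snoc_mem_spacedTuples _ _).1 hP, Fin.snoc_init_self P⟩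

theorem genSeries_spacedTuples_zero (i s : ℕ) :
    genSeries (spacedTuples 0 i s) tupleWeight tupleCharge = 1 := by
  have huniv : spacedTuples 0 i s = {Fin.elim0} := by
    ext P
    simp [spacedTuples, eq_iff_true_of_subsingleton]
  rw [huniv, genSeries_singleton]
  simp [tupleWeight, tupleCharge]

theorem genSeries_spacedTuples {i : ℕ} (hi : 0 < i) (K s : ℕ) :
    genSeries (spacedTuples K i s) tupleWeight tupleCharge =
      rescale (X ^ (2 * s)) (multiSum i K) := by
  induction K generalizing s with
  | zero => rw [genSeries_spacedTuples_zero, multiSum, if_neg hi.ne', map_one]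
  | succ K ih =>
    rw [genSeries_eq_of_bijOn (bijOn_snoc K i s)
      (w := fun p => p.1.sum + tupleWeight p.2)
      (c := fun p => (K + 1) * p.1.length + tupleCharge p.2)
      (fun p _ => by simp [tupleCharge, Fin.sum_univ_castSucc, add_comm])
      (fun p _ => by simp [tupleWeight, Fin.sum_univ_castSucc, add_comm])]
    ext1 m
    have hcoeff := coeff_rescale_X_pow_mul_layerSum K.succ_pos m.lt_succ_self (2 * s) 0 (K + 2 - i)
      (multiSum i K)
    simp only [pow_zero, one_mul] at hcoeff
    rw [multiSum, hcoeff, coeff_genSeries_sigma K.succ_pos m.lt_succ_self (finiteFibers_list _)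
      (T := fun r => spacedTuples K i (s + r)) fun r => finiteFibers_tuple _]
    refine sum_congr rfl fun r _ => ?_
    rw [coeff_genSeries_spaced_two_mul, ih, rescale_layer, mul_add]

/-! ### Partitions with bounded frequencies -/

/-- The multisets of positive integers with `f_j + f_{j+1} ≤ K` for all `j ≥ 1` and `f_1 < i`, where
`f_j` is the multiplicity of `j`. With a strict bound on `f_1` there are none for `i = 0`. -/
def freqMultisets (K i : ℕ) : Set (Multiset ℕ) :=
  {s | 0 ∉ s ∧ (∀ j, s.count (j + 1) + s.count (j + 2) ≤ K) ∧ s.count 1 < i}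

theorem finiteFibers_multiset (S : Set (Multiset ℕ)) (m : ℕ) :
    FiniteFibers {s ∈ S | s.card = m} Multiset.sum := fun n => by
  refine ((finite_setOf_length_le_sum_le m n).image ((↑) : List ℕ → Multiset ℕ)).subset ?_
  rintro s ⟨⟨-, hcard⟩, hsum⟩
  exact ⟨s.toList, ⟨by simp [hcard], by simp [hsum]⟩, s.coe_toList⟩

/-- Raises all elements of a multiset by `1` and adds `a` ones. On partitions this adds a first
column to the Young diagram. -/
def addOnes (a : ℕ) (s : Multiset ℕ) : Multiset ℕ :=
  Multiset.replicate a 1 + s.map (· + 1)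

theorem card_addOnes (a : ℕ) (s : Multiset ℕ) : (addOnes a s).card = s.card + a := by
  simp [addOnes, add_comm]

theorem sum_addOnes (a : ℕ) (s : Multiset ℕ) : (addOnes a s).sum = s.sum + (s.card + a) := by
  simp only [addOnes, Multiset.sum_add, Multiset.sum_replicate, Multiset.sum_map_add,
    Multiset.map_id', Multiset.map_const', smul_eq_mul, mul_one]
  ring

theorem zero_notMem_addOnes (a : ℕ) (s : Multiset ℕ) : 0 ∉ addOnes a s := by
  simp [addOnes, Multiset.mem_replicate]

theorem count_succ_addOnes (a : ℕ) (s : Multiset ℕ) (j : ℕ) :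
    (addOnes a s).count (j + 1) = (if j = 0 then a else 0) + s.count j := by
  rw [addOnes, Multiset.count_add, Multiset.count_replicate,
    Multiset.count_map_eq_count' _ _ (add_left_injective 1)]
  simp

theorem addOnes_injective (a : ℕ) : (addOnes a).Injective := fun _ _ h =>
  Multiset.map_injective (add_left_injective 1) (add_left_cancel h)

theorem exists_addOnes_eq {t : Multiset ℕ} (ht : 0 ∉ t) : ∃ s, addOnes (t.count 1) s = t := by
  refine ⟨(t.filter (· ≠ 1)).map (· - 1), ?_⟩
  have hmap : ((t.filter (· ≠ 1)).map (· - 1)).map (· + 1) = t.filter (· ≠ 1) := by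
    rw [Multiset.map_map]
    refine (Multiset.map_congr rfl fun x hx => ?_).trans (Multiset.map_id _)
    exact Nat.sub_add_cancel (Nat.pos_of_ne_zero fun h =>
      ht (h ▸ Multiset.mem_of_mem_filter hx))
  rw [addOnes, hmap, ← Multiset.filter_eq', Multiset.filter_add_not]

theorem addOnes_mem_freqMultisets {a c : ℕ} {s : Multiset ℕ} :
    addOnes a s ∈ {t ∈ freqMultisets (a + c) (a + 1) | t.count 1 = a} ↔
      s ∈ freqMultisets (a + c) (c + 1) := by
  have hone : (addOnes a s).count 1 = a ↔ 0 ∉ s := by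
    rw [count_succ_addOnes, ← Multiset.count_eq_zero]
    simp
  have hforall := Nat.and_forall_add_one
    (p := fun j => (addOnes a s).count (j + 1) + (addOnes a s).count (j + 2) ≤ a + c)
  simp only [freqMultisets, Set.mem_ofPred_eq, hone, ← hforall, zero_notMem_addOnes,
    not_false_eq_true]
  simp only [count_succ_addOnes, ← Multiset.count_eq_zero]
  grind

theorem bijOn_addOnes (a c : ℕ) :
    Set.BijOn (addOnes a) (freqMultisets (a + c) (c + 1))
      {t ∈ freqMultisets (a + c) (a + 1) | t.count 1 = a} := by
  refine ⟨fun s => addOnes_mem_freqMultisets.2, (addOnes_injective a).injOn, fun t ht => ?_⟩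
  obtain ⟨s, hs⟩ := exists_addOnes_eq ht.1.1
  rw [ht.2] at hs
  rw [← hs] at ht
  exact ⟨s, addOnes_mem_freqMultisets.1 ht, hs⟩

theorem freqMultisets_succ_sep_count_ne (K a : ℕ) :
    {t ∈ freqMultisets K (a + 1) | ¬ t.count 1 = a} = freqMultisets K a := by
  ext t
  simp only [freqMultisets, Set.mem_ofPred_eq]
  grind

theorem freqMultisets_index_zero (K : ℕ) : freqMultisets K 0 = ∅ := by
  simp [freqMultisets]

theorem freqMultisets_sep_card_eq_zero (K a : ℕ) :
    {s ∈ freqMultisets K (a + 1) | s.card = 0} = {0} := by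
  ext s
  simp only [Set.mem_ofPred_eq, Multiset.card_eq_zero, Set.mem_singleton_iff, and_iff_right_iff_imp]
  rintro rfl
  simp [freqMultisets]

theorem andrewsSystem_freqMultisets (K : ℕ) :
    AndrewsSystem K fun i => genSeries (freqMultisets K i) Multiset.sum Multiset.card where
  index_zero := by rw [freqMultisets_index_zero, genSeries_empty]
  constantCoeff_succ a := by
    rw [constantCoeff_genSeries (freqMultisets_sep_card_eq_zero K a), Multiset.sum_zero, pow_zero]
  index_succ := by
    rintro a c rfl
    rw [genSeries_eq_add (finiteFibers_multiset _) (fun t => t.count 1 = a),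
      freqMultisets_succ_sep_count_ne, add_comm, genSeries_bijOn (t := 1) (bijOn_addOnes a c)
        (fun s _ => card_addOnes a s) (fun s _ => (sum_addOnes a s).trans (by rw [one_mul]))]
    simp only [map_mul, map_pow, rescale_X, pow_one, mul_pow, mul_assoc]

/-! ### Differences and frequencies -/

theorem le_getElem_iff_lt_countP {α : Type*} [Preorder α] [DecidableLE α] {s : List α}
    (hs : s.Pairwise (· ≥ ·)) (v : α) {l : ℕ} (hl : l < s.length) :
    v ≤ s[l] ↔ l < s.countP (v ≤ ·) := by
  induction s generalizing l with
  | nil => simp at hl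
  | cons x s ih =>
    rw [List.pairwise_cons] at hs
    by_cases hx : v ≤ x
    · rw [List.countP_cons_of_pos (by simpa using hx)]
      cases l with
      | zero => simpa using hx
      | succ l => simpa using ih hs.2 (by simpa using hl)
    · have hv : ∀ y ∈ x :: s, ¬ v ≤ y := by
        rintro y hy hvy
        rcases List.mem_cons.1 hy with rfl | hy
        exacts [hx hvy, hx (hvy.trans (hs.1 y hy))]
      have hzero : (x :: s).countP (v ≤ ·) = 0 := List.countP_eq_zero.2 (by simpa using hv)
      simp only [hzero, Nat.not_lt_zero, iff_false]
      exact hv _ (List.getElem_mem hl)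

theorem countP_le_eq_add (s : List ℕ) (v : ℕ) :
    s.countP (v ≤ ·) = s.count v + s.countP (v + 1 ≤ ·) := by
  induction s with
  | nil => rfl
  | cons x s ih =>
    simp only [List.countP_cons, List.count_cons, ih]
    grind

theorem countP_le_eq_add_add (s : List ℕ) (v : ℕ) :
    s.countP (v ≤ ·) = s.count v + s.count (v + 1) + s.countP (v + 2 ≤ ·) := by
  rw [countP_le_eq_add s v, countP_le_eq_add s (v + 1), ← add_assoc]

theorem forall_getElem_add_two_le_iff {s : List ℕ} (hs : s.Pairwise (· ≥ ·)) (d : ℕ) :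
    (∀ l, ∀ _ : l + d < s.length, s[l + d] + 2 ≤ s[l]) ↔
      ∀ j, s.count j + s.count (j + 1) ≤ d := by
  refine ⟨fun h j => ?_, fun h l hl => ?_⟩
  · by_contra! hlt
    have hcount := countP_le_eq_add_add s j
    have hl : s.countP (j + 2 ≤ ·) + d < s.length :=
      (by omega : _ < s.countP (j ≤ ·)).trans_le List.countP_le_length
    have hj : j ≤ s[s.countP (j + 2 ≤ ·) + d] := (le_getElem_iff_lt_countP hs j hl).2 (by omega)
    exact lt_irrefl _ ((le_getElem_iff_lt_countP hs (j + 2) (by omega)).1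
      ((Nat.add_le_add_right hj 2).trans (h _ hl)))
  · have hcount := countP_le_eq_add_add s s[l + d]
    have hlt := (le_getElem_iff_lt_countP hs s[l + d] hl).1 le_rfl
    have hle := h s[l + d]
    exact (le_getElem_iff_lt_countP hs (s[l + d] + 2) (by omega)).2 (by omega)

theorem two_le_getElem_length_sub_iff {s : List ℕ} (hs : s.Pairwise (· ≥ ·)) (h0 : 0 ∉ s) {i : ℕ}
    (hi : 1 ≤ i) :
    (∀ _ : i ≤ s.length, ∀ _ : s.length - i < s.length, 2 ≤ s[s.length - i]) ↔
      s.count 1 ≤ i - 1 := by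
  have hcount : s.countP (0 ≤ ·) = s.count 0 + s.count 1 + s.countP (2 ≤ ·) :=
    countP_le_eq_add_add s 0
  have hlength : s.countP (0 ≤ ·) = s.length := List.countP_eq_length.2 (by simp)
  rw [List.count_eq_zero_of_not_mem h0] at hcount
  simp only [le_getElem_iff_lt_countP hs]
  omega

theorem coe_seq {n : ℕ} (p : n.Partition) : (seq p : Multiset ℕ) = p.parts :=
  Multiset.sort_eq _ _

theorem zero_notMem_parts {n : ℕ} (p : n.Partition) : 0 ∉ p.parts := fun h =>
  (p.parts_pos h).false

theorem diffCond_iff_freqCond {k i : ℕ} (hi : 1 ≤ i) {n : ℕ} (p : n.Partition) :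
    DiffCond k i p ↔ FreqCond k i p := by
  have hsorted : (seq p).Pairwise (· ≥ ·) := Multiset.pairwise_sort _ _
  have h0 : 0 ∉ seq p := by
    rw [← Multiset.mem_coe, coe_seq]
    exact zero_notMem_parts p
  have hcount : ∀ j, p.parts.count j = (seq p).count j := fun j => by
    rw [← coe_seq, Multiset.coe_count]
  simp only [DiffCond, FreqCond, forall_getElem_add_two_le_iff hsorted,
    two_le_getElem_length_sub_iff hsorted h0 hi, hcount]
  refine and_congr_left fun _ => ⟨fun h j _ => h j, fun h j => ?_⟩
  rcases j with _ | j
  · rw [List.count_eq_zero_of_not_mem h0, Nat.zero_add]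
    exact (Nat.le_add_right _ _).trans (h 1 le_rfl)
  · exact h (j + 1) j.succ_pos

theorem parts_mem_freqMultisets {k i : ℕ} (hi : 1 ≤ i) {n : ℕ} (p : n.Partition) :
    p.parts ∈ freqMultisets (k - 1) i ↔ DiffCond k i p := by
  rw [diffCond_iff_freqCond hi, freqMultisets, FreqCond, Set.mem_ofPred_eq, Nat.lt_iff_le_pred hi]
  refine (and_iff_right (zero_notMem_parts p)).trans (and_congr_left fun _ => ?_)
  refine ⟨fun h j hj => ?_, fun h j => h (j + 1) j.succ_pos⟩
  obtain ⟨j, rfl⟩ := Nat.exists_eq_add_of_le' hj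
  exact h j

/-! ### The generating functions of `F` and `G` -/

theorem F_eq_coeff {i : ℕ} (hi : 1 ≤ i) (k n m : ℕ) :
    (F k i n m : ℚ) =
      coeff n (coeff m (genSeries (freqMultisets (k - 1) i) Multiset.sum Multiset.card)) := by
  rw [coeff_coeff_genSeries, F, Nat.cast_inj]
  refine Set.BijOn.ncard_eq (f := Nat.Partition.parts) ⟨?_, fun p _ q _ => Nat.Partition.ext, ?_⟩
  · rintro p ⟨hcard, hp⟩
    exact ⟨(parts_mem_freqMultisets hi p).2 hp, hcard, p.parts_sum⟩
  · rintro s ⟨hs, hcard, hsum⟩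
    have hpos : ∀ {x}, x ∈ s → 0 < x := fun hx => Nat.pos_of_ne_zero fun h => hs.1 (h ▸ hx)
    exact ⟨⟨s, hpos, hsum⟩, ⟨hcard, (parts_mem_freqMultisets hi _).1 hs⟩, rfl⟩

theorem spaced_iff_head {d b : ℕ} {l : List ℕ} :
    Spaced d b l ↔ l.Pairwise (fun x y => x + d ≤ y) ∧ ∀ x ∈ l.head?, b ≤ x := by
  refine and_congr_right fun h => ?_
  cases l with
  | nil => simp
  | cons x l =>
    simp only [List.pairwise_cons] at h
    simp only [List.forall_mem_cons, List.head?_cons, Option.mem_some_iff, forall_eq']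
    grind

theorem spaced_reverse_iff {d b : ℕ} {l : List ℕ} :
    Spaced d b l.reverse ↔ (∀ k, ∀ _ : k + 1 < l.length, l[k + 1] + d ≤ l[k]) ∧
      ∀ h : l ≠ [], b ≤ l.getLast h := by
  have : IsTrans ℕ fun x y => y + d ≤ x := ⟨fun x y z hxy hyz => by omega⟩
  rw [spaced_iff_head, List.pairwise_reverse, ← List.isChain_iff_pairwise,
    List.isChain_iff_getElem, List.head?_reverse]
  refine and_congr Iff.rfl ?_
  rcases eq_or_ne l [] with rfl | hl
  · simp
  · simp [List.getLast?_eq_some_getLast hl, hl]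

theorem seq_injective : Function.Injective fun p : (w : ℕ) × w.Partition => seq p.2 := by
  rintro ⟨w, p⟩ ⟨w', p'⟩ h
  have hparts : p.parts = p'.parts := by
    rw [← coe_seq, ← coe_seq]
    exact congrArg _ h
  obtain rfl : w = w' := by rw [← p.parts_sum, ← p'.parts_sum, hparts]
  rw [Nat.Partition.ext hparts]

theorem exists_seq_eq_reverse {d b : ℕ} (hb : 1 ≤ b) {l : List ℕ} (h : Spaced d b l) :
    ∃ p : (w : ℕ) × w.Partition, seq p.2 = l.reverse := by
  refine ⟨⟨l.sum, l, fun hx => hb.trans (h.2 _ hx), rfl⟩, ?_⟩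
  refine List.Perm.eq_of_pairwise' (r := (· ≥ ·)) (Multiset.pairwise_sort _ _) ?_ ?_
  · exact List.pairwise_reverse.2 (h.1.imp fun hxy => le_of_add_le_left hxy)
  · rw [← Multiset.coe_eq_coe, coe_seq, Multiset.coe_reverse]

theorem reverse_partsAt_mem_spacedTuples {K i : ℕ} {P : MultiPartition (K + 1)} :
    (fun a => (P.partsAt a).reverse) ∈ spacedTuples K i 0 ↔ P.Admissible i := by
  refine forall_congr' fun a => ?_
  simp only [spaced_reverse_iff, List.length_reverse, add_zero]
  rfl

theorem G_eq_coeff (K i n m : ℕ) :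
    (G (K + 1) i n m : ℚ) =
      coeff n (coeff m (genSeries (spacedTuples K i 0) tupleWeight tupleCharge)) := by
  rw [coeff_coeff_genSeries, G, Nat.cast_inj]
  have hweight : ∀ P : MultiPartition (K + 1),
      tupleWeight (fun a => (P.partsAt a).reverse) = P.weight := fun P => by
    simp only [tupleWeight, List.sum_reverse]
    rfl
  have hcharge : ∀ P : MultiPartition (K + 1),
      tupleCharge (fun a => (P.partsAt a).reverse) = P.charge := fun P => by
    simp only [tupleCharge, List.length_reverse]
    rfl
  refine Set.BijOn.ncard_eq (f := fun (P : MultiPartition (K + 1)) a => (P.partsAt a).reverse)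
    ⟨?_, fun P _ Q _ h => ?_, ?_⟩
  · rintro P ⟨hn, hm, hP⟩
    exact ⟨reverse_partsAt_mem_spacedTuples.2 hP, (hcharge P).trans hm, (hweight P).trans hn⟩
  · exact funext fun a => seq_injective (List.reverse_injective (congrFun h a))
  · rintro Q ⟨hQ, hm, hn⟩
    choose P hP using fun a => exists_seq_eq_reverse (by omega) (hQ a)
    obtain rfl : (fun a => (MultiPartition.partsAt (k := K + 1) P a).reverse) = Q :=
      funext fun a => by rw [MultiPartition.partsAt, hP, List.reverse_reverse]
    rw [hweight] at hn
    rw [hcharge] at hm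
    exact ⟨P, ⟨hn, hm, reverse_partsAt_mem_spacedTuples.1 hQ⟩, rfl⟩

end BurgeBressoud

theorem theorem1 (k i : ℕ) (hi : 1 ≤ i) (hik : i ≤ k) (n m : ℕ) :
    BurgeBressoud.F k i n m = BurgeBressoud.G k i n m ∧
    ∀ p : n.Partition, BurgeBressoud.DiffCond k i p ↔ BurgeBressoud.FreqCond k i p := by
  refine ⟨?_, fun p => BurgeBressoud.diffCond_iff_freqCond hi p⟩
  obtain ⟨K, rfl⟩ := Nat.exists_eq_add_of_le' (hi.trans hik)
  have hseries := (BurgeBressoud.andrewsSystem_freqMultisets K).eq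
    (BurgeBressoud.andrewsSystem_multiSum K) hik
  have h : (BurgeBressoud.F (K + 1) i n m : ℚ) = BurgeBressoud.G (K + 1) i n m := by
    rw [BurgeBressoud.F_eq_coeff hi, BurgeBressoud.G_eq_coeff, Nat.add_sub_cancel, hseries,
      BurgeBressoud.genSeries_spacedTuples hi]
    simp
  exact_mod_cast h
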